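/- **Theorem (the basic algorithm enforces CSPS).** *System.* There is an arbitrary set $\mathbb I$ of process identifiers (possibly infinite). Processes do not fail, run asynchronously, and communicate over a network that may lose, duplicate and reorder packets arbitrarily (but neither forges nor alters them). An application message from $i$ to $j$ gives rise to the events $c_i(m)$ (causal-send, requested by the application), $s_i(m)$ (network-send: each transmission or retransmission of $m$ over the network), $r_j(m)$ (receive) and $d_j(m)$ (deliver to the application). *Happens-before* $\to$ between application messages is the transitive closure of: $m_1\to m_2$ if, at some process $i$, $d_i(m_1)$ or $c_i(m_1)$ occurs before $c_i(m_2)$. *Basic algorithm.* Process $i$ keeps a clock $ck_i$, initially $1$; a sliding array $u_i$ of unacked messages (indexed by message id, with initial first index $1$); a sliding map $p_i$ of missing permits, i.e. keys (sender, id), each of which gets the next index when added, $p_i.\mathrm{first}$ being the least index of a present key, or $p_i.\mathrm{next}$ (the index of the next key to be added) if there is none; maps $ls_i,ld_i$ (last id sent to, resp. delivered from, each process; $0$ if none); a FIFO send buffer $sb_i$; and a receive buffer $rb_i[j]$ per sender $j$, a finite map keyed by predecessor ids. All buffers are initially empty. The following handlers run atomically. - *trySend*: while $sb_i$ is non-empty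 and its first message $m$ satisfies $m.\mathrm{per}\le p_i.\mathrm{first}$: remove $m$ from $sb_i$, replace $m.\mathrm{per}$ by the flag "$u_i$ is non-empty", append $m$ to $u_i$, and network-send $m$ to its receiver. - *causalSend of payload $x$ to $j$*: append to $sb_i$ a message with receiver $j$, id $ck_i$, predecessor id $ls_i[j]$, $\mathrm{per}=p_i.\mathrm{next}$ and payload $x$; set $ls_i[j]\gets ck_i$ and $ck_i\gets ck_i+1$; then trySend. - *receive message $m$ from $j$*: if $m.\mathrm{mid}\le ld_i[j]$, send an ack of $m.\mathrm{mid}$ to $j$ and stop. Otherwise store $m$ in $rb_i[j]$ under the key $m.\mathrm{pid}$ (its predecessor id), and while $ld_i[j]$ is a key of $rb_i[j]$: remove its entry $b$, set $ld_i[j]\gets b.\mathrm{mid}$, if $b$ is flagged add $(j,b.\mathrm{mid})$ to $p_i$, send an ack of $b.\mathrm{mid}$ to $j$, and deliver $b$. - *receive ack $n$ from $j$*: if $n<u_i.\mathrm{first}$, send a permit for $n$ to $j$ and stop. Otherwise mark $u_i[n]$ as acked; if $n=u_i.\mathrm{first}$, remove it, and then, while $u_i$ is non-empty, look at its first message $m$: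 if $m$ is flagged, send a permit for $m.\mathrm{mid}$ to $m.\mathrm{rcv}$; if $m$ is not acked, stop; otherwise remove $m$. - *receive permit $n$ from $j$*: remove $(j,n)$ from $p_i$ (if present); then trySend. - *periodically*: network-send again every unacked message in $u_i$, and for every $(j,n)$ in $p_i$ send an ack of $n$ to $j$. *Claim.* In every execution of the system in which all processes run this algorithm, Conservative Sender Permission to Send (CSPS) is enforced: whenever a process $i$ network-sends a message $m$, every message $m'$ with $m'\to m$ that was sent by some other process $k\ne i$ that sent messages to $i$ has already been delivered (by the receiver of $m'$). -/

import Mathlib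

namespace CausalDelivery

/-! ## Application messages, events, happens-before, CSPS -/

/-- An application message. It is identified by its sender and its id `mid` (unique per sender);
`rcv` is its destination and `pl` its payload. -/
structure AppMsg (I P : Type*) where
  snd : I
  rcv : I
  mid : ℕ
  pl : P

/-- The four kinds of events concerning application messages, each at a process `i`:
causal-send `c_i(m)`, network-send `s_i(m)`, receive `r_i(m)` and deliver `d_i(m)`. -/
inductive Event (I P : Type*) where
  | causalSend (i : I) (m : AppMsg I P)
  | networkSend (i : I) (m : AppMsg I P)
  | receive (i : I) (m : AppMsg I P)
  | deliver (i : I) (m : AppMsg I P)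

section Trace

variable {I P : Type*}

/-- In the trace `tr` (events in the order in which they occur), `e₁` occurs before `e₂`. -/
def OccursBefore (tr : List (Event I P)) (e₁ e₂ : Event I P) : Prop :=
  List.Sublist [e₁, e₂] tr

/-- The two generating cases of happens-before between application messages: at some process `i`,
`d_i(m₁)` or `c_i(m₁)` occurs before `c_i(m₂)`. -/
def DirectlyHappensBefore (tr : List (Event I P)) (m₁ m₂ : AppMsg I P) : Prop :=
  ∃ i : I, OccursBefore tr (.deliver i m₁) (.causalSend i m₂) ∨
    OccursBefore tr (.causalSend i m₁) (.causalSend i m₂)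

/-- Happens-before between application messages: the transitive closure. -/
def HappensBefore (tr : List (Event I P)) : AppMsg I P → AppMsg I P → Prop :=
  Relation.TransGen (DirectlyHappensBefore tr)

/-- Process `k` sent (at any time in the trace) some message to process `i`. -/
def SentMessagesTo (tr : List (Event I P)) (k i : I) : Prop :=
  ∃ a : AppMsg I P, a.rcv = i ∧ Event.causalSend k a ∈ tr

/-- Conservative Sender Permission to Send: whenever a process `i` network-sends a message `m`
(first transmission or retransmission), every message that happened before `m` and was sent by
some other process `k` that sent messages to `i` has already been delivered by its receiver. -/
def EnforcesCSPS (tr : List (Event I P)) : Prop :=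
  ∀ (i : I) (m : AppMsg I P) (pre post : List (Event I P)),
    tr = pre ++ Event.networkSend i m :: post →
    ∀ k : I, k ≠ i → SentMessagesTo tr k i →
    ∀ m' : AppMsg I P, Event.causalSend k m' ∈ tr → HappensBefore tr m' m →
      Event.deliver m'.rcv m' ∈ pre

end Trace

/-! ## Sliding array and sliding map -/

/-- A sliding array: `elems` occupies the indices `first, …, first + elems.length - 1`. -/
structure SlidingArray (α : Type*) where
  first : ℕ
  elems : List α

namespace SlidingArray

variable {α : Type*}

def size (u : SlidingArray α) : ℕ := u.elems.length

/-- Append an element, at the index following the last one. -/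
def add (u : SlidingArray α) (a : α) : SlidingArray α := ⟨u.first, u.elems ++ [a]⟩

/-- Remove the first element. -/
def remove (u : SlidingArray α) : SlidingArray α :=
  match u.elems with
  | [] => u
  | _ :: l => ⟨u.first + 1, l⟩

/-- Modify the element at index `n` (used for `u.first ≤ n`; no effect beyond the window). -/
def modifyAt (u : SlidingArray α) (n : ℕ) (f : α → α) : SlidingArray α :=
  ⟨u.first, u.elems.modify (n - u.first) f⟩

end SlidingArray

/-- A sliding map: the slot at index `first + n` holds the key added at that index, or `none` if
that key has been removed. -/
structure SlidingMap (E : Type*) where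
  first : ℕ
  slots : List (Option E)

namespace SlidingMap

variable {E : Type*}

/-- The index that the next added key will get. -/
def next (p : SlidingMap E) : ℕ := p.first + p.slots.length

/-- The keys currently present. -/
def keys (p : SlidingMap E) : List E := p.slots.filterMap id

def add (p : SlidingMap E) (e : E) : SlidingMap E := ⟨p.first, p.slots ++ [some e]⟩

/-- Advance `first` past the empty slots, up to the first present key or to `next`. -/
def advance : ℕ → List (Option E) → SlidingMap E
  | n, [] => ⟨n, []⟩
  | n, none :: l => advance (n + 1) l
  | n, some e :: l => ⟨n, some e :: l⟩

/-- Remove a key (no effect if it is absent), and advance `first` if its slot became empty. -/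
def remove [DecidableEq E] (p : SlidingMap E) (e : E) : SlidingMap E :=
  advance p.first (p.slots.map fun o => if o = some e then none else o)

end SlidingMap

/-! ## The basic unicast algorithm -/

/-- A message in the send buffer; `per` is a permit index. -/
structure BufMsg (I P : Type*) where
  rcv : I
  mid : ℕ
  pid : ℕ
  per : ℕ
  pl : P

/-- A message in the unacked buffer; `per` is the permit flag, and `pl` becomes `none` (bottom)
once the message is acked. -/
structure UnackedMsg (I P : Type*) where
  rcv : I
  mid : ℕ
  pid : ℕ
  per : Bool
  pl : Option P

/-- Permit records. -/
structure Per (I : Type*) where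
  snd : I
  mid : ℕ
deriving DecidableEq

/-- Receive buffer records. -/
structure Rcv (P : Type*) where
  mid : ℕ
  pl : P
  per : Bool

/-- What travels in the network: messages (with id, predecessor id, permit flag and payload),
acks and permits. -/
inductive Wire (P : Type*) where
  | msg (mid pid : ℕ) (per : Bool) (pl : P)
  | ack (n : ℕ)
  | permit (n : ℕ)

/-- The externally visible actions of a handler: sending `w` to process `dst` over the network,
or delivering to the application the message with id `mid` and payload `pl` from `snd`. -/
inductive Action (I P : Type*) where
  | send (dst : I) (w : Wire P)
  | deliver (snd : I) (mid : ℕ) (pl : P)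

/-- Local state of a process. Maps into `ℕ` have the value `0` at unmapped keys. -/
structure State (I P : Type*) where
  /-- clock for message ids -/
  ck : ℕ
  /-- unacked messages -/
  u : SlidingArray (UnackedMsg I P)
  /-- missing permits -/
  p : SlidingMap (Per I)
  /-- last sent message ids, per destination -/
  ls : I → ℕ
  /-- last delivered message ids, per sender -/
  ld : I → ℕ
  /-- send buffer -/
  sb : List (BufMsg I P)
  /-- receive buffer: for each sender, a finite map from predecessor ids -/
  rb : I → Finmap (fun _ : ℕ => Rcv P)

/-- Message ids, and hence the indices of the unacked buffer, start at `1`: the value `0` in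
`ls` and `ld` (and in `pid`) stands for "no message". -/
def State.init (I P : Type*) : State I P where
  ck := 1
  u := ⟨1, []⟩
  p := ⟨0, []⟩
  ls := fun _ => 0
  ld := fun _ => 0
  sb := []
  rb := fun _ => ∅

section Algorithm

variable {I P : Type*}

/-- The loop of `trySend`: `pfirst` is the first index of the missing permits; the arguments and
the results are the send buffer and the unacked buffer. -/
def trySendLoop (pfirst : ℕ) : List (BufMsg I P) → SlidingArray (UnackedMsg I P) →
    List (BufMsg I P) × SlidingArray (UnackedMsg I P) × List (Action I P)
  | [], u => ([], u, [])
  | m :: sb, u =>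
    if pfirst < m.per then (m :: sb, u, [])
    else
      let flag : Bool := decide (0 < u.size)
      let r := trySendLoop pfirst sb (u.add ⟨m.rcv, m.mid, m.pid, flag, some m.pl⟩)
      (r.1, r.2.1, Action.send m.rcv (Wire.msg m.mid m.pid flag m.pl) :: r.2.2)

def trySend (s : State I P) : State I P × List (Action I P) :=
  let r := trySendLoop s.p.first s.sb s.u
  ({ s with sb := r.1, u := r.2.1 }, r.2.2)

/-- The handler of `causalSend_i(j, x)`. -/
def onCausalSend [DecidableEq I] (s : State I P) (j : I) (x : P) :
    State I P × List (Action I P) :=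
  trySend { s with
    ls := Function.update s.ls j s.ck
    ck := s.ck + 1
    sb := s.sb ++ [⟨j, s.ck, s.ls j, s.p.next, x⟩] }

/-- The delivery loop for the sender `j`, on the buffered messages `e` from `j`, the id `ld` of the
last delivered message from `j`, and the missing permits `p`. -/
def deliverLoop (j : I) (e : Finmap (fun _ : ℕ => Rcv P)) (ld : ℕ) (p : SlidingMap (Per I)) :
    Finmap (fun _ : ℕ => Rcv P) × ℕ × SlidingMap (Per I) × List (Action I P) :=
  match _h : e.lookup ld with
  | none => (e, ld, p, [])
  | some b =>
    let p' := if b.per then p.add ⟨j, b.mid⟩ else p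
    let r := deliverLoop j (e.erase ld) b.mid p'
    (r.1, r.2.1, r.2.2.1,
      Action.send j (Wire.ack b.mid) :: Action.deliver j b.mid b.pl :: r.2.2.2)
termination_by e.keys.card
decreasing_by
  rw [Finmap.keys_erase]
  exact Finset.card_erase_lt_of_mem
    (Finmap.mem_keys.2 (Finmap.mem_of_lookup_eq_some _h))

/-- The handler of `receive_i(j, msg, m)`. -/
def onMsg [DecidableEq I] (s : State I P) (j : I) (mid pid : ℕ) (per : Bool) (x : P) :
    State I P × List (Action I P) :=
  if mid ≤ s.ld j then (s, [Action.send j (Wire.ack mid)])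
  else
    let r := deliverLoop j ((s.rb j).insert pid ⟨mid, x, per⟩) (s.ld j) s.p
    ({ s with
        rb := Function.update s.rb j r.1
        ld := Function.update s.ld j r.2.1
        p := r.2.2.1 }, r.2.2.2)

/-- The loop of the ack handler, run on the unacked buffer with first index `n` and the given
elements: it sends the permits of flagged messages, and removes leading acked messages. -/
def ackLoop : ℕ → List (UnackedMsg I P) → SlidingArray (UnackedMsg I P) × List (Action I P)
  | n, [] => (⟨n, []⟩, [])
  | n, m :: l =>
    let permits := if m.per then [Action.send m.rcv (Wire.permit m.mid)] else []
    if m.pl.isSome then (⟨n, m :: l⟩, permits)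
    else
      let r := ackLoop (n + 1) l
      (r.1, permits ++ r.2)

/-- The handler of `receive_i(j, ack, n)`. -/
def onAck (s : State I P) (j : I) (n : ℕ) : State I P × List (Action I P) :=
  if n < s.u.first then (s, [Action.send j (Wire.permit n)])
  else
    let u := s.u.modifyAt n fun m => { m with pl := none }
    if n = u.first then
      let r := ackLoop u.remove.first u.remove.elems
      ({ s with u := r.1 }, r.2)
    else ({ s with u := u }, [])

/-- The handler of `receive_i(j, permit, n)`. -/
def onPermit [DecidableEq I] (s : State I P) (j : I) (n : ℕ) :
    State I P × List (Action I P) :=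
  trySend { s with p := s.p.remove ⟨j, n⟩ }

/-- The periodic retransmissions: unacked messages, and acks for the missing permits. -/
def onPeriodic (s : State I P) : State I P × List (Action I P) :=
  (s, (s.u.elems.filterMap fun m =>
        m.pl.map fun x => Action.send m.rcv (Wire.msg m.mid m.pid m.per x)) ++
      s.p.keys.map fun q => Action.send q.snd (Wire.ack q.mid))

/-- What can trigger a handler at a process. -/
inductive Input (I P : Type*) where
  | causalSend (j : I) (x : P)
  | receive (j : I) (w : Wire P)
  | periodic

def handle [DecidableEq I] (s : State I P) : Input I P → State I P × List (Action I P)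
  | .causalSend j x => onCausalSend s j x
  | .receive j (.msg mid pid per x) => onMsg s j mid pid per x
  | .receive j (.ack n) => onAck s j n
  | .receive j (.permit n) => onPermit s j n
  | .periodic => onPeriodic s

/-! ## Executions -/

/-- The event recorded when an input is handled at process `i` in local state `s`. -/
def inputEvents (i : I) (s : State I P) : Input I P → List (Event I P)
  | .causalSend j x => [.causalSend i ⟨i, j, s.ck, x⟩]
  | .receive j (.msg mid _ _ x) => [.receive i ⟨j, i, mid, x⟩]
  | .receive _ (.ack _) => []
  | .receive _ (.permit _) => []
  | .periodic => []

/-- The event recorded for an action at process `i`. -/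
def actionEvents (i : I) : Action I P → List (Event I P)
  | .send j (.msg mid _ _ x) => [.networkSend i ⟨i, j, mid, x⟩]
  | .send _ (.ack _) => []
  | .send _ (.permit _) => []
  | .deliver j mid x => [.deliver i ⟨j, i, mid, x⟩]

/-- A packet put in the network. -/
structure Packet (I P : Type*) where
  src : I
  dst : I
  wire : Wire P

/-- The packets sent from process `i` by a list of actions. -/
def packetsOf (i : I) (acts : List (Action I P)) : Set (Packet I P) :=
  {q | q.src = i ∧ Action.send q.dst q.wire ∈ acts}

/-- The global configuration: the local states and the packets sent so far. -/
structure Config (I P : Type*) where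
  st : I → State I P
  net : Set (Packet I P)

def Config.init (I P : Type*) : Config I P := ⟨fun _ => State.init I P, ∅⟩

/-- An input is possible at `i` unless it is the reception of a packet that was never sent to `i`.
Packets stay in `net` for ever and need not be received: the network may lose, duplicate and
reorder packets arbitrarily. -/
def Enabled (net : Set (Packet I P)) (i : I) : Input I P → Prop
  | .causalSend _ _ => True
  | .receive j w => (⟨j, i, w⟩ : Packet I P) ∈ net
  | .periodic => True

/-- The finite executions of the system in which every process runs the basic algorithm:
`Execution c tr` holds if the configuration `c` can be reached from the initial one through the
trace `tr`. Each step is the (atomic) run of one handler at one process. -/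
inductive Execution [DecidableEq I] : Config I P → List (Event I P) → Prop
  | init : Execution (Config.init I P) []
  | step {c : Config I P} {tr : List (Event I P)} (i : I) (a : Input I P) :
      Execution c tr → Enabled c.net i a →
      Execution
        ⟨Function.update c.st i (handle (c.st i) a).1,
          c.net ∪ packetsOf i (handle (c.st i) a).2⟩
        (tr ++ inputEvents i (c.st i) a ++ (handle (c.st i) a).2.flatMap (actionEvents i))

end Algorithm

end CausalDelivery

/-!
The proof is by an inductive invariant, `Inv`, over executions.

Packets are certificates: an ack of `n` certifies that the message `n` has been delivered, while a
permit for `n`, as well as a message with id `n` and without the permit flag, certifies that *all*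
messages of the same sender with smaller ids have been delivered (`PacketOK`). Indeed the ids in the
unacked buffer are consecutive and everything below its first index has been acked; a message is
unflagged only if it enters an empty buffer, and a permit is granted only once the message has
reached the front of the buffer or has left it. Acks are valid for duplicates too, since
the predecessor ids force each receiver to deliver the messages of a given sender in the order of their ids (`RecvOK.ld`).

The heart of the argument is `Frontier`: each message of another sender in the causal past of a
process `i` has been delivered or is covered by a missing permit of `i`, namely one of the same
sender for a larger id. It is preserved when `i` delivers a message `m` of `j`
(`Inv.deliver_step`): the messages of senders other than `j` in the past of `m` were delivered
before `j` network-sent `m`, and those of `j` have smaller ids, so that they have been delivered if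
`m` is unflagged and are covered by the permit that `i` now waits for otherwise. It is preserved
when a permit arrives (`Inv.onPermit`) by what permits certify. A causally sent message inherits the
frontier of its sender, restricted to the permit indices below its own permit index (`BufOK`).
Once `p.first` has reached that index no permit is missing there, so that all messages of other
senders in the past of the message have been delivered when it is network-sent
(`SendOK.trySend_step`).

This gives more than is asked: the messages of all other processes `k` in the past of the message
have been delivered, whether or not `k` sends messages to `i`.

Only causal-sends and deliveries matter for happens-before, so that the invariant is stated for the
subsequence `core tr` of these events.
-/

namespace CausalDelivery

/-! ### Traces -/

section Trace

variable {I P : Type*}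

/-- The events that happens-before refers to: causal-sends and deliveries. -/
def Event.isCausal : Event I P → Bool
  | .causalSend _ _ => true
  | .deliver _ _ => true
  | .networkSend _ _ => false
  | .receive _ _ => false

/-- The causal-sends and deliveries of a trace, in order. -/
def core (t : List (Event I P)) : List (Event I P) := t.filter Event.isCausal

theorem core_append (t s : List (Event I P)) : core (t ++ s) = core t ++ core s :=
  List.filter_append ..

theorem mem_core {t : List (Event I P)} {e : Event I P} : e ∈ core t ↔ e ∈ t ∧ e.isCausal :=
  List.mem_filter

theorem OccursBefore.core {t : List (Event I P)} {a b : Event I P} (h : OccursBefore t a b)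
    (ha : a.isCausal) (hb : b.isCausal) : OccursBefore (core t) a b := by
  have := List.Sublist.filter Event.isCausal h
  simpa [ha, hb, OccursBefore, CausalDelivery.core] using this

theorem HappensBefore.core {t : List (Event I P)} {x y : AppMsg I P} (h : HappensBefore t x y) :
    HappensBefore (core t) x y :=
  Relation.TransGen.mono (fun _ _ ⟨i, hi⟩ =>
    ⟨i, hi.imp (fun h => h.core rfl rfl) (fun h => h.core rfl rfl)⟩) _ _ h

/-- The message was causally sent by its sender. -/
def Sent (t : List (Event I P)) (m : AppMsg I P) : Prop := Event.causalSend m.snd m ∈ t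

/-- The message was delivered by its receiver. -/
def Delivered (t : List (Event I P)) (m : AppMsg I P) : Prop := Event.deliver m.rcv m ∈ t

/-- All messages of `k` with id below `n` have been delivered. -/
def DeliveredBelow (t : List (Event I P)) (k : I) (n : ℕ) : Prop :=
  ∀ m, Sent t m → m.snd = k → m.mid < n → Delivered t m

/-- All messages that happened before `m` and have another sender have been delivered. -/
def PastDelivered (t : List (Event I P)) (m : AppMsg I P) : Prop :=
  ∀ x, HappensBefore t x m → x.snd ≠ m.snd → Delivered t x

/-- The properties of the traces of executions that do not mention local states. -/
structure WellFormed (t : List (Event I P)) : Prop where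
  snd_eq : ∀ i m, Event.causalSend i m ∈ t → m.snd = i
  inj : ∀ m m', Sent t m → Sent t m' → m.snd = m'.snd → m.mid = m'.mid → m = m'
  deliver : ∀ i m, Event.deliver i m ∈ t → m.rcv = i ∧ Sent t m
  /-- happens-before increases the ids of messages of one sender -/
  mid_lt : ∀ x y, HappensBefore t x y → x.snd = y.snd → x.mid < y.mid
  past : ∀ m, Delivered t m → PastDelivered t m

variable {t t' s : List (Event I P)}

theorem OccursBefore.left_mem {a b : Event I P} (h : OccursBefore t a b) : a ∈ t :=
  List.Sublist.subset h (by simp)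

theorem OccursBefore.right_mem {a b : Event I P} (h : OccursBefore t a b) : b ∈ t :=
  List.Sublist.subset h (by simp)

theorem OccursBefore.of_append {a b : Event I P} (h : OccursBefore (t ++ s) a b) (hb : b ∉ s) :
    OccursBefore t a b := by
  obtain ⟨l₁, l₂, hl, h₁, h₂⟩ := List.sublist_append_iff.1 h
  rcases List.eq_nil_or_concat l₂ with rfl | ⟨l, e, rfl⟩
  · rw [List.append_nil] at hl
    rw [OccursBefore, hl]
    exact h₁
  · rw [List.concat_eq_append, ← List.append_assoc] at hl
    have : b = e := by
      have := congrArg List.getLast? hl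
      simpa using this
    exact absurd (h₂.subset (by simp [this])) hb

theorem OccursBefore.left_mem_of_append_singleton {a b e : Event I P}
    (h : OccursBefore (t ++ [e]) a b) : a ∈ t := by
  have h' := List.Sublist.reverse h
  simp only [List.reverse_append, List.reverse_cons, List.reverse_nil, List.nil_append,
    List.singleton_append] at h'
  cases h' with
  | cons _ h => exact List.mem_reverse.1 (h.subset (by simp))
  | cons_cons _ h => exact List.mem_reverse.1 (h.subset (by simp))

theorem WellFormed.sent_of_event (h : WellFormed t) {i : I} {m : AppMsg I P}
    (hm : Event.deliver i m ∈ t ∨ Event.causalSend i m ∈ t) : Sent t m := by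
  rcases hm with hm | hm
  · exact (h.deliver _ _ hm).2
  · rw [Sent, h.snd_eq _ _ hm]
    exact hm

theorem WellFormed.sent_of_directly (h : WellFormed t) {x y : AppMsg I P}
    (hxy : DirectlyHappensBefore t x y) : Sent t x := by
  obtain ⟨i, hi⟩ := hxy
  exact h.sent_of_event (hi.imp OccursBefore.left_mem OccursBefore.left_mem)

theorem WellFormed.sent_left (h : WellFormed t) {x y : AppMsg I P}
    (hxy : HappensBefore t x y) : Sent t x := by
  obtain ⟨z, hz, -⟩ := Relation.TransGen.head'_iff.1 hxy
  exact h.sent_of_directly hz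

/-- Extending a trace does not change the past of a message that is not sent again. -/
theorem HappensBefore.of_append (h : WellFormed t)
    (hs : ∀ i m, Sent t m → Event.causalSend i m ∉ s) {x y : AppMsg I P}
    (hxy : HappensBefore (t ++ s) x y) (hy : Sent t y) : HappensBefore t x y := by
  have key : ∀ x y, DirectlyHappensBefore (t ++ s) x y → Sent t y →
      DirectlyHappensBefore t x y := fun x y ⟨i, hi⟩ hy =>
    ⟨i, hi.imp (fun h => h.of_append (hs i y hy)) (fun h => h.of_append (hs i y hy))⟩
  induction hxy with
  | single h1 => exact .single (key _ _ h1 hy)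
  | tail _ h1 ih =>
    have h2 := key _ _ h1 hy
    exact .tail (ih (h.sent_of_directly h2)) h2

/-- The trace `t'` extends `t`, and the messages that are sent in `t'` only carry ids between the
old clock `ck` and the new clock `ck'` of their sender. -/
structure Extends (ck ck' : I → ℕ) (t t' : List (Event I P)) : Prop where
  ck_le : ∀ i, ck i ≤ ck' i
  sent : ∀ m, Sent t m → Sent t' m
  fresh : ∀ m, Sent t' m → Sent t m ∨ (ck m.snd ≤ m.mid ∧ m.mid < ck' m.snd)
  delivered : ∀ m, Delivered t m → Delivered t' m
  hb : ∀ x y, HappensBefore t' x y → Sent t y → HappensBefore t x y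

theorem Extends.refl (ck : I → ℕ) (t : List (Event I P)) : Extends ck ck t t :=
  ⟨fun _ => le_rfl, fun _ h => h, fun _ h => .inl h, fun _ h => h, fun _ _ h _ => h⟩

theorem sent_append_deliver {i : I} {m m' : AppMsg I P} :
    Sent (t ++ [Event.deliver i m]) m' ↔ Sent t m' := by
  simp [Sent]

theorem HappensBefore.of_append_deliver {i : I} {m x y : AppMsg I P}
    (h : HappensBefore (t ++ [Event.deliver i m]) x y) : HappensBefore t x y :=
  Relation.TransGen.mono (fun _ _ ⟨k, hk⟩ =>
    ⟨k, hk.imp (fun h => h.of_append (by simp)) (fun h => h.of_append (by simp))⟩) _ _ h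

theorem extends_deliver (ck : I → ℕ) (t : List (Event I P)) (i : I) (m : AppMsg I P) :
    Extends ck ck t (t ++ [Event.deliver i m]) where
  ck_le _ := le_rfl
  sent _ := sent_append_deliver.2
  fresh _ h := .inl (sent_append_deliver.1 h)
  delivered _ h := List.mem_append_left _ h
  hb _ _ h _ := h.of_append_deliver

theorem WellFormed.append_deliver (h : WellFormed t) {m : AppMsg I P} (hm : Sent t m)
    (hp : PastDelivered t m) : WellFormed (t ++ [Event.deliver m.rcv m]) where
  snd_eq i m' hm' := h.snd_eq i m' (by simpa using hm')
  inj _ _ h₁ h₂ := h.inj _ _ (sent_append_deliver.1 h₁) (sent_append_deliver.1 h₂)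
  deliver i m' hm' := by
    rw [sent_append_deliver]
    simp only [List.mem_append, List.mem_singleton, Event.deliver.injEq] at hm'
    rcases hm' with hm' | ⟨rfl, rfl⟩
    · exact h.deliver _ _ hm'
    · exact ⟨rfl, hm⟩
  mid_lt _ _ hxy := h.mid_lt _ _ hxy.of_append_deliver
  past m' hm' x hx hne := by
    replace hx := hx.of_append_deliver
    refine List.mem_append_left _ ?_
    simp only [Delivered, List.mem_append, List.mem_singleton, Event.deliver.injEq] at hm'
    rcases hm' with hm' | ⟨-, rfl⟩
    · exact h.past _ hm' _ hx hne
    · exact hp _ hx hne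

theorem sent_append_causalSend {m m' : AppMsg I P} :
    Sent (t ++ [Event.causalSend m.snd m]) m' ↔ Sent t m' ∨ m' = m := by
  simp only [Sent, List.mem_append, List.mem_singleton, Event.causalSend.injEq]
  exact or_congr_right ⟨And.right, fun h => ⟨by rw [h], h⟩⟩

theorem delivered_append_causalSend {i : I} {m m' : AppMsg I P} :
    Delivered (t ++ [Event.causalSend i m]) m' ↔ Delivered t m' := by
  simp [Delivered]

theorem HappensBefore.of_append_causalSend (h : WellFormed t) {m x y : AppMsg I P}
    (hm : ¬ Sent t m) (hxy : HappensBefore (t ++ [Event.causalSend m.snd m]) x y)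
    (hy : Sent t y) : HappensBefore t x y := by
  refine HappensBefore.of_append h (fun i m' hm' hc => ?_) hxy hy
  simp only [List.mem_singleton, Event.causalSend.injEq] at hc
  exact hm (hc.2 ▸ hm')

/-- The past of a newly sent message is the past of the earlier events of its sender. -/
theorem HappensBefore.of_causalSend (h : WellFormed t) {m x : AppMsg I P}
    (hm : ¬ Sent t m) (hx : HappensBefore (t ++ [Event.causalSend m.snd m]) x m) :
    ∃ y, (Event.deliver m.snd y ∈ t ∨ Event.causalSend m.snd y ∈ t) ∧
      Relation.ReflTransGen (DirectlyHappensBefore t) x y := by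
  obtain ⟨y, hxy, i, hi⟩ := Relation.TransGen.tail'_iff.1 hx
  have him : i = m.snd := by
    have : Event.causalSend i m ∈ t ++ [Event.causalSend m.snd m] :=
      hi.elim OccursBefore.right_mem OccursBefore.right_mem
    simp only [List.mem_append, List.mem_singleton, Event.causalSend.injEq, and_true] at this
    exact this.elim (fun h' => (h.snd_eq _ _ h').symm) id
  subst him
  have hy : Event.deliver m.snd y ∈ t ∨ Event.causalSend m.snd y ∈ t :=
    hi.imp OccursBefore.left_mem_of_append_singleton OccursBefore.left_mem_of_append_singleton
  refine ⟨y, hy, ?_⟩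
  rcases Relation.reflTransGen_iff_eq_or_transGen.1 hxy with rfl | hxy
  · exact .refl
  · exact (HappensBefore.of_append_causalSend h hm hxy (h.sent_of_event hy)).to_reflTransGen

theorem extends_causalSend [DecidableEq I] (h : WellFormed t) {ck : I → ℕ} {m : AppMsg I P}
    (hck : ∀ m', Sent t m' → m'.mid < ck m'.snd) (hm : m.mid = ck m.snd) :
    Extends ck (Function.update ck m.snd (ck m.snd + 1)) t
      (t ++ [Event.causalSend m.snd m]) where
  ck_le i := by
    by_cases hi : i = m.snd
    · subst hi; simp
    · simp [hi]
  sent _ h' := sent_append_causalSend.2 (.inl h')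
  fresh m' h' := by
    rcases sent_append_causalSend.1 h' with h' | rfl
    · exact .inl h'
    · right; simp [hm]
  delivered _ h' := delivered_append_causalSend.2 h'
  hb _ _ hxy hy := hxy.of_append_causalSend h (fun hs => (hck m hs).ne hm) hy

theorem WellFormed.append_causalSend (h : WellFormed t) {m : AppMsg I P}
    (hm : ∀ m', Sent t m' → m'.snd = m.snd → m'.mid < m.mid) :
    WellFormed (t ++ [Event.causalSend m.snd m]) := by
  have hns : ¬ Sent t m := fun hs => (hm m hs rfl).false
  constructor
  · intro i m' hm'
    simp only [List.mem_append, List.mem_singleton, Event.causalSend.injEq] at hm'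
    rcases hm' with hm' | ⟨rfl, rfl⟩
    · exact h.snd_eq _ _ hm'
    · rfl
  · intro a b ha hb hsnd hmid
    rcases sent_append_causalSend.1 ha with ha' | rfl <;>
      rcases sent_append_causalSend.1 hb with hb' | rfl
    · exact h.inj _ _ ha' hb' hsnd hmid
    · exact absurd hmid (hm _ ha' hsnd).ne
    · exact absurd hmid (hm _ hb' hsnd.symm).ne'
    · rfl
  · intro i m' hm'
    have := h.deliver i m' (by simpa using hm')
    exact ⟨this.1, sent_append_causalSend.2 (.inl this.2)⟩
  · intro x y hxy hsnd
    have hy : Sent t y ∨ y = m := by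
      obtain ⟨z, -, i, hi⟩ := Relation.TransGen.tail'_iff.1 hxy
      have : Event.causalSend i y ∈ t ++ [Event.causalSend m.snd m] :=
        hi.elim OccursBefore.right_mem OccursBefore.right_mem
      simp only [List.mem_append, List.mem_singleton, Event.causalSend.injEq] at this
      exact this.imp (fun h' => h.sent_of_event (.inr h')) And.right
    rcases hy with hy | rfl
    · exact h.mid_lt _ _ (hxy.of_append_causalSend h hns hy) hsnd
    · obtain ⟨z, hz, hxz⟩ := hxy.of_causalSend h hns
      refine hm x ?_ hsnd
      rcases Relation.reflTransGen_iff_eq_or_transGen.1 hxz with rfl | hxz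
      · exact h.sent_of_event hz
      · exact h.sent_left hxz
  · intro m' hm' x hx hne
    rw [delivered_append_causalSend] at hm' ⊢
    exact h.past m' hm' x (hx.of_append_causalSend h hns (h.deliver _ _ hm').2) hne

end Trace

/-! ### The sliding map of missing permits -/

section Pending

variable {I P : Type*}

/-- A permit that covers the message `x`, i.e. one of the same sender for a larger id, is missing
at an index below `b`. -/
def Pending (p : SlidingMap (Per I)) (b : ℕ) (x : AppMsg I P) : Prop :=
  ∃ k n, p.slots[k]? = some (some ⟨x.snd, n⟩) ∧ p.first + k < b ∧ x.mid < n

variable {p : SlidingMap (Per I)} {b : ℕ} {x : AppMsg I P}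

theorem Pending.add (h : Pending p b x) (e : Per I) : Pending (p.add e) b x := by
  obtain ⟨k, n, hk, hb, hn⟩ := h
  refine ⟨k, n, ?_, hb, hn⟩
  rw [SlidingMap.add, List.getElem?_append_left (List.getElem?_eq_some_iff.1 hk).1, hk]

theorem Pending.mono (h : Pending p b x) {b' : ℕ} (hb : b ≤ b') : Pending p b' x := by
  obtain ⟨k, n, hk, hlt, hn⟩ := h
  exact ⟨k, n, hk, hlt.trans_le hb, hn⟩

theorem pending_add {n : ℕ} (hn : x.mid < n) :
    Pending (p.add ⟨x.snd, n⟩) (p.add ⟨x.snd, n⟩).next x :=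
  ⟨p.slots.length, n, by simp [SlidingMap.add], by simp [SlidingMap.add, SlidingMap.next], hn⟩

theorem not_pending_of_le_first (h : b ≤ p.first) : ¬ Pending p b x := by
  rintro ⟨k, n, -, hk, -⟩
  omega

/-- Advancing `first` keeps the indices of the present keys. -/
theorem advance_getElem? {E : Type*} {e : E} : ∀ (n k : ℕ) (l : List (Option E)),
    l[k]? = some (some e) → ∃ k', (SlidingMap.advance n l).slots[k']? = some (some e) ∧
      (SlidingMap.advance n l).first + k' = n + k
  | _, _, [], h => by simp at h
  | n, 0, none :: l, h => by simp at h
  | n, k + 1, none :: l, h => by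
    obtain ⟨k', h₁, h₂⟩ := advance_getElem? (n + 1) k l (by simpa using h)
    exact ⟨k', h₁, by rw [SlidingMap.advance, h₂]; omega⟩
  | n, k, some e' :: l, h => ⟨k, h, rfl⟩

theorem next_advance {E : Type*} : ∀ (n : ℕ) (l : List (Option E)),
    (SlidingMap.advance n l).next = n + l.length
  | _, [] => rfl
  | n, none :: l => by
    rw [SlidingMap.advance, next_advance, List.length_cons]; omega
  | _, some _ :: _ => rfl

theorem next_remove [DecidableEq I] (p : SlidingMap (Per I)) (e : Per I) :
    (p.remove e).next = p.next := by
  rw [SlidingMap.remove, next_advance, List.length_map, SlidingMap.next]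

theorem mem_slots_advance {E : Type*} {o : Option E} : ∀ {n : ℕ} {l : List (Option E)},
    o ∈ (SlidingMap.advance n l).slots → o ∈ l
  | _, [], h => h
  | _, none :: _, h => List.mem_cons_of_mem _ (mem_slots_advance h)
  | _, some _ :: _, h => h

theorem mem_slots_remove [DecidableEq I] {e q : Per I}
    (h : some q ∈ (p.remove e).slots) : some q ∈ p.slots := by
  obtain ⟨o, ho, h'⟩ := List.mem_map.1 (mem_slots_advance h)
  split_ifs at h'
  exact h' ▸ ho

/-- Removing a key uncovers only messages with smaller ids of the sender in that key. -/
theorem Pending.remove [DecidableEq I] (h : Pending p b x) (j : I) (n : ℕ) :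
    (x.snd = j ∧ x.mid < n) ∨ Pending (p.remove ⟨j, n⟩) b x := by
  obtain ⟨k, n', hk, hb, hn⟩ := h
  by_cases he : (⟨x.snd, n'⟩ : Per I) = ⟨j, n⟩
  · simp only [Per.mk.injEq] at he
    exact .inl ⟨he.1, he.2 ▸ hn⟩
  · right
    obtain ⟨k', h₁, h₂⟩ := advance_getElem? (e := (⟨x.snd, n'⟩ : Per I)) p.first k
      (p.slots.map fun o => if o = some (⟨j, n⟩ : Per I) then none else o)
      (by simp only [List.getElem?_map, hk, Option.map_some, Option.some.injEq, if_neg he])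
    exact ⟨k', n', h₁, h₂ ▸ hb, hn⟩

end Pending

/-! ### The invariant -/

section Invariant

variable {I P : Type*}

/-- No message from `i` to `j` has an id strictly between `pid` and `mid`. -/
def NoGap (t : List (Event I P)) (i j : I) (pid mid : ℕ) : Prop :=
  ∀ m, Sent t m → m.snd = i → m.rcv = j → m.mid < mid → m.mid ≤ pid

/-- What holds for a message that `i` has network-sent to `j`. A message without the permit flag
certifies that all earlier messages of its sender have been delivered. -/
structure MsgOK (t : List (Event I P)) (i j : I) (mid pid : ℕ) (per : Bool) (x : P) : Prop where
  sent : Sent t ⟨i, j, mid, x⟩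
  noGap : NoGap t i j pid mid
  flag : per = false → DeliveredBelow t i mid
  past : PastDelivered t ⟨i, j, mid, x⟩

/-- The meaning of a packet in the network: an ack of `n` certifies the delivery of the message
`n`, and a permit for `n` that of all messages with smaller ids from the same sender. -/
def PacketOK (t : List (Event I P)) (ck : I → ℕ) (q : Packet I P) : Prop :=
  match q.wire with
  | .msg mid pid per x => MsgOK t q.src q.dst mid pid per x
  | .ack n => ∃ x, Sent t ⟨q.dst, q.src, n, x⟩ ∧ Delivered t ⟨q.dst, q.src, n, x⟩
  | .permit n => DeliveredBelow t q.src n ∧ n ≤ ck q.src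

/-- The invariant of an entry of the send buffer of `i`: each message of another sender in its
past has been delivered, or is covered by a missing permit that the entry waits for. -/
structure BufOK (t : List (Event I P)) (i : I) (p : SlidingMap (Per I)) (e : BufMsg I P) :
    Prop where
  sent : Sent t ⟨i, e.rcv, e.mid, e.pl⟩
  noGap : NoGap t i e.rcv e.pid e.mid
  past : ∀ x, HappensBefore t x ⟨i, e.rcv, e.mid, e.pl⟩ → x.snd ≠ i →
    Delivered t x ∨ Pending p e.per x

/-- The invariant of an entry of the unacked buffer of `i`. -/
def UnackedOK (t : List (Event I P)) (i : I) (e : UnackedMsg I P) : Prop :=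
  ∃ x, MsgOK t i e.rcv e.mid e.pid e.per x ∧
    (e.pl = some x ∨ (e.pl = none ∧ Delivered t ⟨i, e.rcv, e.mid, x⟩))

/-- The invariant of the sending side of process `i`. The ids in the unacked buffer and the send
buffer are consecutive, so that the index of an unacked message is its id. -/
structure SendOK (t : List (Event I P)) (ck : I → ℕ) (i : I) (s : State I P) : Prop where
  ck_eq : s.ck = ck i
  ls : ∀ m, Sent t m → m.snd = i → m.mid ≤ s.ls m.rcv
  first_le : s.u.first ≤ ck i
  ids : s.u.elems.map UnackedMsg.mid ++ s.sb.map BufMsg.mid =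
    List.range' s.u.first (ck i - s.u.first)
  below : DeliveredBelow t i s.u.first
  unacked : ∀ e ∈ s.u.elems, UnackedOK t i e
  buffered : ∀ e ∈ s.sb, BufOK t i s.p e

/-- The invariant of the receiving side of process `i`. -/
structure RecvOK (t : List (Event I P)) (ck : I → ℕ) (i : I) (s : State I P) : Prop where
  rb : ∀ j k b, (s.rb j).lookup k = some b → MsgOK t j i b.mid k b.per b.pl
  /-- the messages of a sender are delivered to `i` in the order of their ids -/
  ld : ∀ m, Sent t m → m.rcv = i → m.mid ≤ s.ld m.snd → Delivered t m
  ld_lt : ∀ j, s.ld j < ck j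
  /-- a permit is only requested for a delivered message, so that the periodic acks are valid -/
  keys : ∀ q, some q ∈ s.p.slots → PacketOK t ck ⟨i, q.snd, .ack q.mid⟩

/-- Each message of another sender in the causal past of process `i`, that is, in the reflexive past
of a message that `i` has delivered or causally sent, has been delivered, or is
covered by a missing permit of `i`. -/
def Frontier (t : List (Event I P)) (i : I) (p : SlidingMap (Per I)) : Prop :=
  ∀ x y, (Event.deliver i y ∈ t ∨ Event.causalSend i y ∈ t) →
    Relation.ReflTransGen (DirectlyHappensBefore t) x y → x.snd ≠ i →
    Delivered t x ∨ Pending p p.next x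

/-- The global invariant, on the local states `st`, the packets `N`, and the trace `t` of
causal-sends and deliveries; `ck` gives the clocks. -/
structure Inv (ck : I → ℕ) (st : I → State I P) (N : Set (Packet I P))
    (t : List (Event I P)) : Prop where
  trace : WellFormed t
  ck_pos : ∀ i, 0 < ck i
  sent_pos : ∀ m, Sent t m → 0 < m.mid
  sent_lt : ∀ m, Sent t m → m.mid < ck m.snd
  send : ∀ i, SendOK t ck i (st i)
  recv : ∀ i, RecvOK t ck i (st i)
  frontier : ∀ i, Frontier t i (st i).p
  net : ∀ q ∈ N, PacketOK t ck q

/-! ### Stability of the invariant under extensions of the trace -/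

variable {t t' : List (Event I P)} {ck ck' : I → ℕ}

theorem DeliveredBelow.mono {k : I} {n : ℕ} (h : DeliveredBelow t k n)
    (ext : Extends ck ck' t t') (hn : n ≤ ck k) : DeliveredBelow t' k n := by
  intro m hm hk hlt
  rcases ext.fresh m hm with hm | ⟨hm, -⟩
  · exact ext.delivered _ (h m hm hk hlt)
  · subst hk
    omega

theorem NoGap.mono {i j : I} {pid mid : ℕ} (h : NoGap t i j pid mid)
    (ext : Extends ck ck' t t') (hn : mid ≤ ck i) : NoGap t' i j pid mid := by
  intro m hm hi hj hlt
  rcases ext.fresh m hm with hm | ⟨hm, -⟩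
  · exact h m hm hi hj hlt
  · subst hi
    omega

theorem PastDelivered.mono {m : AppMsg I P} (h : PastDelivered t m) (ext : Extends ck ck' t t')
    (hm : Sent t m) : PastDelivered t' m :=
  fun x hx hne => ext.delivered _ (h x (ext.hb _ _ hx hm) hne)

theorem MsgOK.mono {i j : I} {mid pid : ℕ} {per : Bool} {x : P} (h : MsgOK t i j mid pid per x)
    (ext : Extends ck ck' t t') (hlt : ∀ m, Sent t m → m.mid < ck m.snd) :
    MsgOK t' i j mid pid per x where
  sent := ext.sent _ h.sent
  noGap := h.noGap.mono ext (hlt _ h.sent).le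
  flag hf := (h.flag hf).mono ext (hlt _ h.sent).le
  past := h.past.mono ext h.sent

theorem PacketOK.mono {q : Packet I P} (h : PacketOK t ck q)
    (ext : Extends ck ck' t t') (hlt : ∀ m, Sent t m → m.mid < ck m.snd) :
    PacketOK t' ck' q := by
  obtain ⟨src, dst, w⟩ := q
  cases w with
  | msg mid pid per x => exact MsgOK.mono h ext hlt
  | ack n =>
    obtain ⟨x, h₁, h₂⟩ := h
    exact ⟨x, ext.sent _ h₁, ext.delivered _ h₂⟩
  | permit n => exact ⟨h.1.mono ext h.2, h.2.trans (ext.ck_le _)⟩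

theorem BufOK.mono {i : I} {p p' : SlidingMap (Per I)} {e : BufMsg I P} (h : BufOK t i p e)
    (wf : WellFormed t) (ext : Extends ck ck' t t') (hlt : ∀ m, Sent t m → m.mid < ck m.snd)
    (hp : ∀ b x, Sent t x → Pending p b x → Delivered t' x ∨ Pending p' b x) :
    BufOK t' i p' e where
  sent := ext.sent _ h.sent
  noGap := h.noGap.mono ext (hlt _ h.sent).le
  past x hx hne :=
    have hx := ext.hb _ _ hx h.sent
    (h.past x hx hne).elim (fun h => .inl (ext.delivered _ h)) (hp _ x (wf.sent_left hx))

theorem UnackedOK.mono {i : I} {e : UnackedMsg I P} (h : UnackedOK t i e)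
    (ext : Extends ck ck' t t') (hlt : ∀ m, Sent t m → m.mid < ck m.snd) : UnackedOK t' i e := by
  obtain ⟨x, h₁, h₂⟩ := h
  exact ⟨x, h₁.mono ext hlt, h₂.imp_right fun h => ⟨h.1, ext.delivered _ h.2⟩⟩

/-- The sending side only depends on the receiving side through the missing permits. -/
theorem SendOK.mono {i : I} {s s' : State I P} (h : SendOK t ck i s)
    (wf : WellFormed t) (ext : Extends ck ck' t t') (hlt : ∀ m, Sent t m → m.mid < ck m.snd)
    (hck : ck' i = ck i)
    (h_ck : s'.ck = s.ck) (hu : s'.u = s.u) (hls : s'.ls = s.ls) (hsb : s'.sb = s.sb)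
    (hp : ∀ b x, Sent t x → Pending s.p b x → Delivered t' x ∨ Pending s'.p b x) :
    SendOK t' ck' i s' where
  ck_eq := by rw [h_ck, hck, h.ck_eq]
  ls m hm hi := by
    rw [hls]
    rcases ext.fresh m hm with hm | ⟨h₁, h₂⟩
    · exact h.ls m hm hi
    · subst hi
      omega
  first_le := by rw [hu, hck]; exact h.first_le
  ids := by rw [hu, hck, hsb]; exact h.ids
  below := by rw [hu]; exact h.below.mono ext h.first_le
  unacked := by rw [hu]; exact fun e he => (h.unacked e he).mono ext hlt
  buffered := by rw [hsb]; exact fun e he => (h.buffered e he).mono wf ext hlt hp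

theorem RecvOK.mono {i : I} {s s' : State I P} (h : RecvOK t ck i s)
    (ext : Extends ck ck' t t') (hlt : ∀ m, Sent t m → m.mid < ck m.snd)
    (hrb : s'.rb = s.rb) (hld : s'.ld = s.ld)
    (hp : ∀ q, some q ∈ s'.p.slots → some q ∈ s.p.slots) : RecvOK t' ck' i s' where
  rb j k b hb := (h.rb j k b (hrb ▸ hb)).mono ext hlt
  ld m hm hi hle := by
    rw [hld] at hle
    rcases ext.fresh m hm with hm | ⟨h₁, -⟩
    · exact ext.delivered _ (h.ld m hm hi hle)
    · exact absurd (h.ld_lt m.snd) (by omega)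
  ld_lt j := by rw [hld]; exact (h.ld_lt j).trans_le (ext.ck_le j)
  keys q hq := (h.keys q (hp q hq)).mono ext hlt

/-- The causal past of a message that is sent in `t` is not enlarged by extending `t`. -/
theorem reflTransGen_of_extends (ext : Extends ck ck' t t') {x y : AppMsg I P} (hy : Sent t y)
    (h : Relation.ReflTransGen (DirectlyHappensBefore t') x y) :
    Relation.ReflTransGen (DirectlyHappensBefore t) x y := by
  rcases Relation.reflTransGen_iff_eq_or_transGen.1 h with rfl | h
  · exact .refl
  · exact (ext.hb _ _ h hy).to_reflTransGen

theorem Frontier.mono {i : I} {p : SlidingMap (Per I)} (h : Frontier t i p) (wf : WellFormed t)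
    (ext : Extends ck ck' t t') {x y : AppMsg I P}
    (hy : Event.deliver i y ∈ t ∨ Event.causalSend i y ∈ t)
    (hxy : Relation.ReflTransGen (DirectlyHappensBefore t') x y) (hne : x.snd ≠ i) :
    Delivered t' x ∨ Pending p p.next x :=
  (h x y hy (reflTransGen_of_extends ext (wf.sent_of_event hy) hxy) hne).imp_left
    (ext.delivered _)

/-- A step at process `i` preserves the invariant if it does so for the parts that concern `i`
and for the new packets. -/
theorem Inv.step [DecidableEq I] {st : I → State I P} {N M : Set (Packet I P)}
    (h : Inv ck st N t) (wf : WellFormed t') (ext : Extends ck ck' t t') {i : I}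
    {s' : State I P}
    (hev : ∀ k, k ≠ i → ∀ y, (Event.deliver k y ∈ t' ∨ Event.causalSend k y ∈ t') →
      (Event.deliver k y ∈ t ∨ Event.causalSend k y ∈ t))
    (hck : ∀ k, k ≠ i → ck' k = ck k) (hsend : SendOK t' ck' i s') (hrecv : RecvOK t' ck' i s')
    (hfront : Frontier t' i s'.p) (hnet : ∀ q ∈ M, PacketOK t' ck' q) :
    Inv ck' (Function.update st i s') (N ∪ M) t' where
  trace := wf
  ck_pos k := (h.ck_pos k).trans_le (ext.ck_le k)
  sent_pos m hm := (ext.fresh m hm).elim (h.sent_pos m) fun h' => (h.ck_pos _).trans_le h'.1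
  sent_lt m hm := (ext.fresh m hm).elim (fun h' => (h.sent_lt m h').trans_le (ext.ck_le _))
    fun h' => h'.2
  send k := by
    by_cases hk : k = i
    · subst hk; simpa using hsend
    · rw [Function.update_of_ne hk]
      exact (h.send k).mono h.trace ext h.sent_lt (hck k hk) rfl rfl rfl rfl fun _ _ _ h => .inr h
  recv k := by
    by_cases hk : k = i
    · subst hk; simpa using hrecv
    · rw [Function.update_of_ne hk]
      exact (h.recv k).mono ext h.sent_lt rfl rfl fun _ => id
  frontier k := by
    by_cases hk : k = i
    · subst hk; simpa using hfront
    · rw [Function.update_of_ne hk]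
      exact fun x y hy hxy hne => (h.frontier k).mono h.trace ext (hev k hk y hy) hxy hne
  net q hq := hq.elim (fun hq => (h.net q hq).mono ext h.sent_lt) (hnet q)

/-- The case of a step without causal-sends and deliveries. -/
theorem Inv.local_step [DecidableEq I] {st : I → State I P} {N M : Set (Packet I P)}
    (h : Inv ck st N t) {i : I} {s' : State I P} (hsend : SendOK t ck i s')
    (hrecv : RecvOK t ck i s') (hfront : Frontier t i s'.p) (hnet : ∀ q ∈ M, PacketOK t ck q) :
    Inv ck (Function.update st i s') (N ∪ M) t :=
  h.step h.trace (.refl ck t) (fun _ _ _ => id) (fun _ _ => rfl) hsend hrecv hfront hnet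

/-! ### The handlers -/

/-- The sends among the actions `acts` of process `i` put valid packets in the network. -/
def ActionsOK (t : List (Event I P)) (ck : I → ℕ) (i : I) (acts : List (Action I P)) : Prop :=
  ∀ dst w, Action.send dst w ∈ acts → PacketOK t ck ⟨i, dst, w⟩

theorem ActionsOK.packets {i : I} {acts : List (Action I P)} (h : ActionsOK t ck i acts) :
    ∀ q ∈ packetsOf i acts, PacketOK t ck q := by
  rintro ⟨src, dst, w⟩ ⟨rfl, hq⟩
  exact h _ _ hq

/-- Only acked messages have lost their payload. -/
theorem UnackedOK.delivered {i : I} {e : UnackedMsg I P} (wf : WellFormed t)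
    (h : UnackedOK t i e) (he : e.pl.isSome = false) {m : AppMsg I P} (hm : Sent t m)
    (hi : m.snd = i) (hmid : m.mid = e.mid) : Delivered t m := by
  obtain ⟨x, h₁, h₂ | h₂⟩ := h
  · simp [h₂] at he
  · rw [wf.inj m _ hm h₁.sent hi hmid]
    exact h₂.2

/-- The first message of the send buffer may be sent once its permit index is reached. -/
theorem SendOK.trySend_step {i : I} {s : State I P} {m : BufMsg I P} {sb : List (BufMsg I P)}
    {u : SlidingArray (UnackedMsg I P)} (h : SendOK t ck i { s with sb := m :: sb, u := u })
    (hm : m.per ≤ s.p.first) :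
    MsgOK t i m.rcv m.mid m.pid (decide (0 < u.size)) m.pl ∧
      SendOK t ck i { s with
        sb := sb, u := u.add ⟨m.rcv, m.mid, m.pid, decide (0 < u.size), some m.pl⟩ } := by
  have hb := h.buffered m (by simp)
  have hids := h.ids
  have hmsg : MsgOK t i m.rcv m.mid m.pid (decide (0 < u.size)) m.pl := by
    refine ⟨hb.sent, hb.noGap, fun hf => ?_, fun x hx hne => ?_⟩
    · -- A message is unflagged only if all earlier ones have left the unacked buffer.
      have hu : u.elems = [] := by
        rw [decide_eq_false_iff_not, not_lt, Nat.le_zero] at hf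
        exact List.length_eq_zero_iff.1 hf
      have : m.mid = u.first := by
        have := congrArg List.head? hids
        simp only [hu, List.map_nil, List.nil_append, List.map_cons, List.head?_cons,
          List.head?_range'] at this
        split at this <;> simp_all
      rw [this]
      exact h.below
    · exact (hb.past x hx hne).resolve_right (not_pending_of_le_first hm)
  exact ⟨hmsg,
    { ck_eq := h.ck_eq
      ls := h.ls
      first_le := h.first_le
      ids := by simpa [SlidingArray.add] using hids
      below := h.below
      unacked := fun e he => by
        simp only [SlidingArray.add, List.mem_append, List.mem_singleton] at he
        rcases he with he | rfl
        · exact h.unacked e he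
        · exact ⟨m.pl, hmsg, .inl rfl⟩
      buffered := fun e he => h.buffered e (List.mem_cons_of_mem _ he) }⟩

theorem trySendLoop_ok {i : I} {s : State I P} : ∀ (sb : List (BufMsg I P))
    (u : SlidingArray (UnackedMsg I P)), SendOK t ck i { s with sb := sb, u := u } →
    SendOK t ck i { s with
      sb := (trySendLoop s.p.first sb u).1, u := (trySendLoop s.p.first sb u).2.1 } ∧
    ActionsOK t ck i (trySendLoop s.p.first sb u).2.2
  | [], u, h => ⟨h, fun _ _ hw => by simp [trySendLoop] at hw⟩
  | m :: sb, u, h => by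
    rw [trySendLoop]
    split_ifs with hm
    · exact ⟨h, fun _ _ hw => by simp at hw⟩
    · obtain ⟨hmsg, hs⟩ := h.trySend_step (not_lt.1 hm)
      obtain ⟨h₁, h₂⟩ := trySendLoop_ok sb _ hs
      refine ⟨h₁, fun dst w hw => ?_⟩
      simp only [List.mem_cons, Action.send.injEq] at hw
      rcases hw with ⟨rfl, rfl⟩ | hw
      · exact hmsg
      · exact h₂ dst w hw

theorem Inv.trySend [DecidableEq I] {st : I → State I P} {N : Set (Packet I P)}
    (h : Inv ck st N t) (i : I) :
    Inv ck (Function.update st i (trySend (st i)).1)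
      (N ∪ packetsOf i (CausalDelivery.trySend (st i)).2) t := by
  obtain ⟨h₁, h₂⟩ := trySendLoop_ok (st i).sb (st i).u (h.send i)
  exact h.local_step h₁ ((h.recv i).mono (.refl ck t) h.sent_lt rfl rfl fun _ => id) (h.frontier i)
    h₂.packets

theorem Inv.onCausalSend [DecidableEq I] {st : I → State I P} {N : Set (Packet I P)}
    (h : Inv ck st N t) (i j : I) (x : P) :
    Inv (Function.update ck i (ck i + 1)) (Function.update st i (onCausalSend (st i) j x).1)
      (N ∪ packetsOf i (CausalDelivery.onCausalSend (st i) j x).2)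
      (t ++ [.causalSend i ⟨i, j, (st i).ck, x⟩]) := by
  set s := st i with hs
  set m : AppMsg I P := ⟨i, j, s.ck, x⟩ with hm
  have hck : s.ck = ck i := (h.send i).ck_eq
  have hwf : WellFormed (t ++ [.causalSend i m]) := h.trace.append_causalSend (m := m)
    fun m' h₁ h₂ => by
      have := h.sent_lt m' h₁
      rw [h₂] at this
      exact this.trans_eq hck.symm
  have hns : ¬ Sent t m := fun h' => (h.sent_lt m h').ne hck
  have ext : Extends ck (Function.update ck i (ck i + 1)) t (t ++ [.causalSend i m]) :=
    extends_causalSend (m := m) h.trace h.sent_lt hck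
  have hpast : ∀ y, HappensBefore (t ++ [.causalSend i m]) y m → y.snd ≠ i →
      Delivered (t ++ [.causalSend i m]) y ∨ Pending s.p s.p.next y := by
    intro y hy hne
    obtain ⟨z, hz, hyz⟩ := hy.of_causalSend (m := m) h.trace hns
    exact (h.frontier i y z hz hyz hne).imp_left (ext.delivered _)
  let s' : State I P := { s with
    ls := Function.update s.ls j s.ck
    ck := s.ck + 1
    sb := s.sb ++ [⟨j, s.ck, s.ls j, s.p.next, x⟩] }
  have hsend : SendOK (t ++ [.causalSend i m]) (Function.update ck i (ck i + 1)) i s' := by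
    have h₀ : SendOK t ck i s := h.send i
    have hfl := h₀.first_le
    refine ⟨by simp [s', hck], ?_, ?_, ?_, ?_, ?_, ?_⟩
    · intro m' hm' hi
      rcases (sent_append_causalSend (m := m)).1 hm' with hm' | rfl
      · by_cases hj : m'.rcv = j
        · have := h.sent_lt m' hm'
          rw [hi] at this
          simp only [s', hj, Function.update_self, hck]
          exact this.le
        · simp only [s', Function.update_of_ne hj]
          exact h₀.ls m' hm' hi
      · simp [s', hm]
    · simp only [s', Function.update_self]
      omega
    · simp only [s', Function.update_self, List.map_append, List.map_cons, List.map_nil]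
      rw [← List.append_assoc, h₀.ids, Nat.sub_add_comm hfl, List.range'_concat]
      simp only [one_mul, hck]
      congr 2
      omega
    · exact h₀.below.mono ext hfl
    · exact fun e he => (h₀.unacked e he).mono ext h.sent_lt
    · intro e he
      simp only [s', List.mem_append, List.mem_singleton] at he
      rcases he with he | rfl
      · exact (h₀.buffered e he).mono h.trace ext h.sent_lt fun _ _ _ h => .inr h
      · refine ⟨(sent_append_causalSend (m := m)).2 (.inr rfl), ?_, hpast⟩
        intro m' hm' hi hj hlt
        rcases (sent_append_causalSend (m := m)).1 hm' with hm₀ | rfl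
        · subst hj
          exact h₀.ls m' hm₀ hi
        · exact absurd hlt (lt_irrefl _)
  have hinv := h.step (M := ∅) (i := i) (s' := s') hwf ext
    (fun k hk y hy => by simpa [hk] using hy) (fun k hk => by simp [hk]) hsend
    ((h.recv i).mono ext h.sent_lt rfl rfl fun _ => id)
    (by
      intro y z hz hyz hne
      by_cases hzm : z = m
      · subst hzm
        rcases Relation.reflTransGen_iff_eq_or_transGen.1 hyz with rfl | hyz
        · exact absurd rfl hne
        · exact hpast y hyz hne
      · exact (h.frontier i).mono h.trace ext (by simpa [hzm] using hz) hyz hne)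
    (by simp)
  have := hinv.trySend i
  rw [CausalDelivery.onCausalSend]
  simpa only [Function.update_self, Function.update_idem, Set.union_empty] using this

theorem Inv.onPermit [DecidableEq I] {st : I → State I P} {N : Set (Packet I P)}
    (h : Inv ck st N t) {i j : I} {n : ℕ} (hq : PacketOK t ck ⟨j, i, .permit n⟩) :
    Inv ck (Function.update st i (onPermit (st i) j n).1)
      (N ∪ packetsOf i (CausalDelivery.onPermit (st i) j n).2) t := by
  have hp : ∀ b x, Sent t x → Pending (st i).p b x →
      Delivered t x ∨ Pending ((st i).p.remove ⟨j, n⟩) b x := fun b x hx hb =>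
    (hb.remove j n).imp_left fun h' => hq.1 x hx h'.1 h'.2
  have hinv := h.local_step (M := ∅) (i := i)
    (s' := { st i with p := (st i).p.remove ⟨j, n⟩ })
    ((h.send i).mono h.trace (.refl ck t) h.sent_lt rfl rfl rfl rfl rfl hp)
    ((h.recv i).mono (.refl ck t) h.sent_lt rfl rfl fun _ => mem_slots_remove)
    (by
      intro x y hy hxy hne
      rw [next_remove]
      refine (h.frontier i x y hy hxy hne).elim .inl (hp _ x ?_)
      rcases Relation.reflTransGen_iff_eq_or_transGen.1 hxy with rfl | hxy
      · exact h.trace.sent_of_event hy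
      · exact h.trace.sent_left hxy)
    (by simp)
  have := hinv.trySend i
  rw [CausalDelivery.onPermit]
  simpa only [Function.update_self, Function.update_idem, Set.union_empty] using this

theorem Inv.onPeriodic [DecidableEq I] {st : I → State I P} {N : Set (Packet I P)}
    (h : Inv ck st N t) (i : I) :
    Inv ck (Function.update st i (onPeriodic (st i)).1)
      (N ∪ packetsOf i (CausalDelivery.onPeriodic (st i)).2) t := by
  refine h.local_step (h.send i) (h.recv i) (h.frontier i) (ActionsOK.packets ?_)
  intro dst w hw
  rcases List.mem_append.1 hw with hw | hw
  · obtain ⟨e, he, hw⟩ := List.mem_filterMap.1 hw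
    obtain ⟨y, hy, hw⟩ := Option.map_eq_some_iff.1 hw
    obtain ⟨x, hx, hpl | hpl⟩ := (h.send i).unacked e he
    · simp only [Action.send.injEq] at hw
      obtain ⟨rfl, rfl⟩ := hw
      obtain rfl : x = y := by simpa [hy] using hpl.symm
      exact hx
    · simp [hy] at hpl
  · obtain ⟨q, hq, hw⟩ := List.mem_map.1 hw
    simp only [Action.send.injEq] at hw
    obtain ⟨rfl, rfl⟩ := hw
    exact (h.recv i).keys q (by simpa [SlidingMap.keys] using hq)

theorem SendOK.mid_eq {i : I} {s : State I P} (h : SendOK t ck i s) {k : ℕ} {e : UnackedMsg I P}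
    (hk : s.u.elems[k]? = some e) : e.mid = s.u.first + k := by
  have hlt := (List.getElem?_eq_some_iff.1 hk).1
  have h₁ := congrArg (fun l => l[k]?) h.ids
  simp only [List.getElem?_append_left (l₁ := s.u.elems.map UnackedMsg.mid)
    (by simpa using hlt), List.getElem?_map, hk, Option.map_some] at h₁
  have h₂ := List.getElem?_eq_some_iff.1 h₁.symm
  obtain ⟨_, h₂⟩ := h₂
  simpa using h₂.symm

theorem SendOK.remove_step {i : I} {s : State I P} {m : UnackedMsg I P}
    {l : List (UnackedMsg I P)} {n : ℕ} (wf : WellFormed t)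
    (h : SendOK t ck i { s with u := ⟨n, m :: l⟩ }) (hm : m.pl.isSome = false) :
    SendOK t ck i { s with u := ⟨n + 1, l⟩ } := by
  have hids : m.mid :: (l.map UnackedMsg.mid ++ s.sb.map BufMsg.mid) =
      List.range' n (ck i - n) := h.ids
  have hmid : m.mid = n := h.mid_eq (k := 0) rfl
  obtain ⟨d, hd⟩ : ∃ d, ck i - n = d + 1 := by
    refine Nat.exists_eq_succ_of_ne_zero fun h0 => ?_
    simp [h0] at hids
  refine ⟨h.ck_eq, h.ls, ?_, ?_, ?_, ?_, h.buffered⟩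
  · change n + 1 ≤ ck i
    omega
  · have hd' : ck i - (n + 1) = d := by omega
    rw [hd, List.range'_succ, List.cons.injEq] at hids
    change _ = List.range' (n + 1) (ck i - (n + 1))
    rw [hd']
    exact hids.2
  · intro m' hm' hi hlt
    rcases Nat.lt_succ_iff_lt_or_eq.1 hlt with hlt | heq
    · exact h.below m' hm' hi hlt
    · exact (h.unacked m (by simp)).delivered wf hm hm' hi (heq.trans hmid.symm)
  · exact fun e he => h.unacked e (List.mem_cons_of_mem _ he)

theorem ackLoop_ok {i : I} {s : State I P} (wf : WellFormed t) :
    ∀ (n : ℕ) (l : List (UnackedMsg I P)), SendOK t ck i { s with u := ⟨n, l⟩ } →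
    SendOK t ck i { s with u := (ackLoop n l).1 } ∧ ActionsOK t ck i (ackLoop n l).2
  | n, [], h => ⟨h, fun _ _ hw => by simp [ackLoop] at hw⟩
  | n, m :: l, h => by
    -- All messages before the head of the buffer are acked, so a permit for it is justified.
    have hpermit : ActionsOK t ck i
        (if m.per then [Action.send m.rcv (Wire.permit m.mid)] else []) := by
      intro dst w hw
      split_ifs at hw
      · simp only [List.mem_singleton, Action.send.injEq] at hw
        obtain ⟨rfl, rfl⟩ := hw
        rw [show m.mid = n from h.mid_eq (k := 0) rfl]
        exact ⟨h.below, h.first_le⟩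
      · simp at hw
    rw [ackLoop]
    by_cases hm : m.pl.isSome
    · simp only [hm, if_true]
      exact ⟨h, hpermit⟩
    · simp only [hm]
      obtain ⟨h₁, h₂⟩ := ackLoop_ok wf (n + 1) l (h.remove_step wf (by simpa using hm))
      exact ⟨h₁, fun dst w hw => (List.mem_append.1 hw).elim (hpermit dst w) (h₂ dst w)⟩

theorem map_modify_of_forall_eq {α β : Type*} {f : α → α} {g : α → β} (hf : ∀ a, g (f a) = g a) :
    ∀ (l : List α) (k : ℕ), (l.modify k f).map g = l.map g
  | [], _ => by simp
  | a :: l, 0 => by simp [hf]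
  | a :: l, k + 1 => by simp [map_modify_of_forall_eq hf l k]

theorem SendOK.modifyAt {i j : I} {s : State I P} {n : ℕ} {x : P} (wf : WellFormed t)
    (h : SendOK t ck i s) (hn : s.u.first ≤ n) (hs : Sent t ⟨i, j, n, x⟩)
    (hd : Delivered t ⟨i, j, n, x⟩) :
    SendOK t ck i { s with u := s.u.modifyAt n fun m => { m with pl := none } } := by
  refine ⟨h.ck_eq, h.ls, h.first_le, ?_, h.below, ?_, h.buffered⟩
  · have := map_modify_of_forall_eq (f := fun m : UnackedMsg I P => { m with pl := none })
      (g := UnackedMsg.mid) (fun _ => rfl) s.u.elems (n - s.u.first)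
    simp only [SlidingArray.modifyAt]
    rw [this]
    exact h.ids
  · intro e he
    obtain ⟨k, hk⟩ := List.mem_iff_getElem?.1 he
    simp only [SlidingArray.modifyAt, List.getElem?_modify] at hk
    obtain ⟨e₀, he₀, hk⟩ := Option.map_eq_some_iff.1 hk
    have hmem := h.unacked e₀ (List.mem_of_getElem? he₀)
    split_ifs at hk with heq
    · subst hk
      obtain ⟨y, hy, -⟩ := hmem
      have hmid : e₀.mid = n := by
        rw [h.mid_eq he₀]
        omega
      refine ⟨y, hy, .inr ⟨rfl, ?_⟩⟩
      have := wf.inj _ _ hy.sent hs rfl hmid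
      change Delivered t ⟨i, e₀.rcv, e₀.mid, y⟩
      rw [this]
      exact hd
    · exact hk ▸ hmem

theorem Inv.onAck [DecidableEq I] {st : I → State I P} {N : Set (Packet I P)}
    (h : Inv ck st N t) {i j : I} {n : ℕ} (hq : PacketOK t ck ⟨j, i, .ack n⟩) :
    Inv ck (Function.update st i (onAck (st i) j n).1)
      (N ∪ packetsOf i (CausalDelivery.onAck (st i) j n).2) t := by
  obtain ⟨x, hs, hd⟩ := hq
  have h₀ := h.send i
  suffices hok : SendOK t ck i (CausalDelivery.onAck (st i) j n).1 ∧
      ActionsOK t ck i (CausalDelivery.onAck (st i) j n).2 by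
    have hp : (CausalDelivery.onAck (st i) j n).1.p = (st i).p ∧
        (CausalDelivery.onAck (st i) j n).1.rb = (st i).rb ∧
        (CausalDelivery.onAck (st i) j n).1.ld = (st i).ld := by
      rw [CausalDelivery.onAck]
      split_ifs
      · simp
      · dsimp only
        split_ifs <;> simp
    refine h.local_step hok.1 ?_ ?_ hok.2.packets
    · exact (h.recv i).mono (.refl ck t) h.sent_lt hp.2.1 hp.2.2 (by simp [hp.1])
    · rw [hp.1]
      exact h.frontier i
  rw [CausalDelivery.onAck]
  by_cases hn : n < (st i).u.first
  · rw [if_pos hn]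
    refine ⟨h₀, fun dst w hw => ?_⟩
    simp only [List.mem_singleton, Action.send.injEq] at hw
    obtain ⟨rfl, rfl⟩ := hw
    exact ⟨fun m hm hi hlt => h₀.below m hm hi (hlt.trans hn), (hn.trans_le h₀.first_le).le⟩
  · rw [if_neg hn]
    have h₁ := h₀.modifyAt h.trace (not_lt.1 hn) hs hd
    dsimp only
    split_ifs with heq
    · apply ackLoop_ok h.trace
      have hfirst : ∀ e l, ((st i).u.modifyAt n fun m => { m with pl := none }).elems = e :: l →
          e.pl.isSome = false := by
        intro e l hel
        have heq' : n - (st i).u.first = 0 := by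
          rw [SlidingArray.modifyAt] at heq
          exact Nat.sub_eq_zero_of_le heq.le
        simp only [SlidingArray.modifyAt, heq'] at hel
        cases hu : (st i).u.elems with
        | nil => simp [hu] at hel
        | cons a l' =>
          simp only [hu, List.modify_zero_cons, List.cons.injEq] at hel
          rw [← hel.1]
          rfl
      generalize (st i).u.modifyAt n (fun m => { m with pl := none }) = u at h₁ hfirst ⊢
      obtain ⟨f, l⟩ := u
      cases l with
      | nil => exact h₁
      | cons e l => exact h₁.remove_step h.trace (hfirst e l rfl)
    · exact ⟨h₁, fun _ _ hw => by simp at hw⟩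

/-- The state of a process in the delivery loop for the sender `j`. -/
def State.inLoop [DecidableEq I] (s : State I P) (j : I) (e : Finmap (fun _ : ℕ => Rcv P))
    (ld : ℕ) (p : SlidingMap (Per I)) : State I P :=
  { s with rb := Function.update s.rb j e, ld := Function.update s.ld j ld, p := p }

/-- One round of the delivery loop. -/
theorem Inv.deliver_step [DecidableEq I] {st : I → State I P} {N : Set (Packet I P)} {i j : I}
    {s : State I P} {e : Finmap (fun _ : ℕ => Rcv P)} {ld : ℕ} {p : SlidingMap (Per I)}
    (h : Inv ck (Function.update st i (s.inLoop j e ld p)) N t) {b : Rcv P}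
    (hb : e.lookup ld = some b) :
    Inv ck (Function.update st i (s.inLoop j (e.erase ld) b.mid
        (if b.per then p.add ⟨j, b.mid⟩ else p)))
      (N ∪ packetsOf i [.send j (.ack b.mid), .deliver j b.mid b.pl])
      (t ++ [.deliver i ⟨j, i, b.mid, b.pl⟩]) := by
  have hsend := h.send i
  have hrecv := h.recv i
  have hfront := h.frontier i
  simp only [Function.update_self] at hsend hrecv hfront
  change Frontier t i p at hfront
  set m : AppMsg I P := ⟨j, i, b.mid, b.pl⟩ with hm
  have hmsg : MsgOK t j i b.mid ld b.per b.pl := hrecv.rb j ld b (by simpa [State.inLoop] using hb)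
  have ext := extends_deliver ck t i m
  have hwf : WellFormed (t ++ [.deliver i m]) :=
    h.trace.append_deliver (m := m) hmsg.sent hmsg.past
  have hdm : Delivered (t ++ [.deliver i m]) m := by simp [Delivered, hm]
  set p' := if b.per then p.add ⟨j, b.mid⟩ else p with hp'
  have hp : ∀ n (x : AppMsg I P), Pending p n x → Pending p' n x := by
    intro n x hx
    rw [hp']
    split_ifs
    · exact hx.add _
    · exact hx
  have hnext : p.next ≤ p'.next := by
    rw [hp']
    split_ifs
    · simp [SlidingMap.add, SlidingMap.next]
    · rfl
  have hack : PacketOK (t ++ [.deliver i m]) ck ⟨i, j, .ack b.mid⟩ :=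
    ⟨b.pl, ext.sent _ hmsg.sent, hdm⟩
  have := h.step (i := i) (M := packetsOf i [.send j (.ack b.mid), .deliver j b.mid b.pl])
    (s' := s.inLoop j (e.erase ld) b.mid p') hwf ext
    (fun k hk y hy => by simpa [hk] using hy) (fun _ _ => rfl)
    (hsend.mono h.trace ext h.sent_lt rfl rfl rfl rfl rfl fun b x _ hx => .inr (hp b x hx)) ?_ ?_
    (ActionsOK.packets fun dst w hw => by
      simp only [List.mem_cons, Action.send.injEq, List.not_mem_nil, reduceCtorEq, or_false] at hw
      obtain ⟨rfl, rfl⟩ := hw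
      exact hack)
  · rwa [Function.update_idem] at this
  · refine ⟨?_, ?_, ?_, ?_⟩
    · intro j' k b' hb'
      refine (hrecv.rb j' k b' ?_).mono ext h.sent_lt
      by_cases hj : j' = j
      · subst hj
        simp only [State.inLoop, Function.update_self] at hb' ⊢
        by_cases hk : k = ld
        · subst hk
          simp at hb'
        · rwa [Finmap.lookup_erase_ne hk] at hb'
      · simpa [State.inLoop, hj] using hb'
    · intro m' hm' hi hle
      replace hm' := sent_append_deliver.1 hm'
      by_cases hj : m'.snd = j
      · -- There is no message for `i` with an id strictly between that of the predecessor, which is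
        -- the last delivered message, and that of the new one.
        simp only [State.inLoop, hj, Function.update_self] at hle
        rcases hle.lt_or_eq with hlt | heq
        · refine ext.delivered _ (hrecv.ld m' hm' hi ?_)
          simpa [State.inLoop, hj] using hmsg.noGap m' hm' hj hi hlt
        · rw [h.trace.inj m' m hm' hmsg.sent hj heq]
          exact hdm
      · refine ext.delivered _ (hrecv.ld m' hm' hi ?_)
        simpa [State.inLoop, hj] using hle
    · intro j'
      by_cases hj : j' = j
      · subst hj
        simpa [State.inLoop] using h.sent_lt _ hmsg.sent
      · have := hrecv.ld_lt j'
        simpa [State.inLoop, hj] using this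
    · intro q hq
      change some q ∈ p'.slots at hq
      have hq' : some q ∈ p.slots ∨ q = ⟨j, b.mid⟩ := by
        rw [hp'] at hq
        split_ifs at hq
        · simpa [SlidingMap.add] using hq
        · exact .inl hq
      rcases hq' with hq' | rfl
      · exact (hrecv.keys q hq').mono ext h.sent_lt
      · exact hack
  · intro x y hy hxy hne
    change Delivered _ x ∨ Pending p' p'.next x
    by_cases hym : y = m
    · subst hym
      -- A delivered message brings the past of its sender into the frontier: the messages of third
      -- processes have been delivered, and so have those of the sender if the message is unflagged;
      -- if it is flagged, they are covered by its missing permit.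
      rcases Relation.reflTransGen_iff_eq_or_transGen.1 (reflTransGen_of_extends ext hmsg.sent hxy)
        with rfl | hx
      · exact .inl hdm
      · by_cases hxj : x.snd = j
        · have hlt : x.mid < b.mid := h.trace.mid_lt x m hx hxj
          cases hper : b.per with
          | false =>
            exact .inl (ext.delivered _
              (hmsg.flag hper x (h.trace.sent_left hx) hxj hlt))
          | true =>
            right
            rw [hp', hper, if_pos rfl, ← hxj]
            exact pending_add hlt
        · exact .inl (ext.delivered _ (hmsg.past x hx hxj))
    · exact (hfront.mono h.trace ext (by simpa [hym] using hy) hxy hne).imp_right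
        fun hx => (hp _ _ hx).mono hnext

theorem packetsOf_append (i : I) (a b : List (Action I P)) :
    packetsOf i (a ++ b) = packetsOf i a ∪ packetsOf i b := by
  ext q
  simp [packetsOf, and_or_left]

theorem Inv.deliverLoop [DecidableEq I] {st : I → State I P} {i j : I} {s : State I P}
    (e : Finmap (fun _ : ℕ => Rcv P)) (ld : ℕ) (p : SlidingMap (Per I)) {N : Set (Packet I P)}
    {t : List (Event I P)} (h : Inv ck (Function.update st i (s.inLoop j e ld p)) N t) :
    Inv ck (Function.update st i (s.inLoop j (deliverLoop j e ld p).1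
        (CausalDelivery.deliverLoop j e ld p).2.1 (CausalDelivery.deliverLoop j e ld p).2.2.1))
      (N ∪ packetsOf i (CausalDelivery.deliverLoop j e ld p).2.2.2)
      (t ++ core ((CausalDelivery.deliverLoop j e ld p).2.2.2.flatMap (actionEvents i))) := by
  rw [CausalDelivery.deliverLoop]
  split
  · simpa [core, packetsOf] using h
  · next b hb =>
    have := Inv.deliverLoop _ _ _ (h.deliver_step hb)
    rw [Set.union_assoc, ← packetsOf_append, List.append_assoc] at this
    simpa [actionEvents, core, Event.isCausal, List.filter_cons] using this
termination_by e.keys.card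
decreasing_by
  rw [Finmap.keys_erase]
  refine Finset.card_erase_lt_of_mem (Finmap.mem_keys.2 ?_)
  apply Finmap.mem_of_lookup_eq_some
  assumption

theorem Inv.onMsg [DecidableEq I] {st : I → State I P} {N : Set (Packet I P)}
    (h : Inv ck st N t) {i j : I} {mid pid : ℕ} {per : Bool} {x : P}
    (hq : PacketOK t ck ⟨j, i, .msg mid pid per x⟩) :
    Inv ck (Function.update st i (onMsg (st i) j mid pid per x).1)
      (N ∪ packetsOf i (CausalDelivery.onMsg (st i) j mid pid per x).2)
      (t ++ core ((CausalDelivery.onMsg (st i) j mid pid per x).2.flatMap (actionEvents i))) := by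
  have hq : MsgOK t j i mid pid per x := hq
  rw [CausalDelivery.onMsg]
  split_ifs with hle
  · have := h.local_step (h.send i) (h.recv i) (h.frontier i) (M := packetsOf i
      [.send j (.ack mid)]) (ActionsOK.packets fun dst w hw => by
        simp only [List.mem_singleton, Action.send.injEq] at hw
        obtain ⟨rfl, rfl⟩ := hw
        exact ⟨x, hq.sent, (h.recv i).ld _ hq.sent rfl hle⟩)
    simpa [actionEvents, core] using this
  · refine Inv.deliverLoop _ _ _ ?_
    have := h.local_step (M := ∅) (i := i)
      (s' := (st i).inLoop j (((st i).rb j).insert pid ⟨mid, x, per⟩) ((st i).ld j) (st i).p)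
      ((h.send i).mono h.trace (.refl ck t) h.sent_lt rfl rfl rfl rfl rfl fun _ _ _ h => .inr h)
      ⟨?_, ?_, ?_, (h.recv i).keys⟩ (h.frontier i) (by simp)
    · simpa using this
    · intro j' k b hb
      by_cases hj : j' = j
      · subst hj
        simp only [State.inLoop, Function.update_self] at hb
        by_cases hk : k = pid
        · subst hk
          rw [Finmap.lookup_insert, Option.some.injEq] at hb
          exact hb ▸ hq
        · rw [Finmap.lookup_insert_of_ne _ hk] at hb
          exact (h.recv i).rb _ _ _ hb
      · exact (h.recv i).rb _ _ _ (by simpa [State.inLoop, hj] using hb)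
    · simpa [State.inLoop] using (h.recv i).ld
    · simpa [State.inLoop] using (h.recv i).ld_lt

end Invariant

/-! ### Executions -/

section Executions

variable {I P : Type*}

theorem inv_init : Inv (fun _ => 1) (fun _ : I => State.init I P) ∅ [] where
  trace := by
    constructor
    · intro i m hm
      simp at hm
    · intro m m' hm
      simp [Sent] at hm
    · intro i m hm
      simp at hm
    · intro x y hxy
      obtain ⟨z, ⟨i, hi⟩, -⟩ := Relation.TransGen.head'_iff.1 hxy
      simp [OccursBefore] at hi
    · intro m hm
      simp [Delivered] at hm
  ck_pos _ := one_pos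
  sent_pos m hm := by simp [Sent] at hm
  sent_lt m hm := by simp [Sent] at hm
  send i := by constructor <;> simp [State.init, Sent, DeliveredBelow]
  recv i := by constructor <;> simp [State.init, Sent]
  frontier i x y hy := by simp at hy
  net q hq := hq.elim

theorem trySend_sends {s : State I P} {a : Action I P} (h : a ∈ (trySend s).2) :
    ∃ dst w, a = .send dst w := by
  rw [trySend] at h
  generalize s.sb = sb, s.u = u at h
  induction sb generalizing u with
  | nil => simp [trySendLoop] at h
  | cons m sb ih =>
    rw [trySendLoop] at h
    split_ifs at h
    · simp at h
    · rcases List.mem_cons.1 h with rfl | h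
      · exact ⟨_, _, rfl⟩
      · exact ih _ h

theorem ackLoop_sends : ∀ {n : ℕ} {l : List (UnackedMsg I P)} {a : Action I P},
    a ∈ (ackLoop n l).2 → ∃ dst n, a = .send dst (.permit n)
  | _, [], _, h => by simp [ackLoop] at h
  | n, m :: l, a, h => by
    have hpermit : a ∈ (if m.per then [Action.send m.rcv (Wire.permit m.mid)] else []) →
        ∃ dst n, a = .send dst (.permit n) := by
      intro h
      split_ifs at h
      · exact ⟨_, _, List.mem_singleton.1 h⟩
      · simp at h
    rw [ackLoop] at h
    dsimp only at h
    by_cases hm : m.pl.isSome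
    · rw [if_pos hm] at h
      exact hpermit h
    · rw [if_neg hm] at h
      exact (List.mem_append.1 h).elim hpermit ackLoop_sends

theorem onAck_sends {s : State I P} {j : I} {n : ℕ} {a : Action I P} (h : a ∈ (onAck s j n).2) :
    ∃ dst w, a = .send dst w := by
  rw [onAck] at h
  split_ifs at h
  · exact ⟨_, _, List.mem_singleton.1 h⟩
  · dsimp only at h
    split_ifs at h
    · obtain ⟨dst, n, rfl⟩ := ackLoop_sends h
      exact ⟨_, _, rfl⟩
    · simp at h

theorem onPeriodic_sends {s : State I P} {a : Action I P} (h : a ∈ (onPeriodic s).2) :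
    ∃ dst w, a = .send dst w := by
  rcases List.mem_append.1 h with h | h
  · obtain ⟨e, -, h⟩ := List.mem_filterMap.1 h
    obtain ⟨y, -, rfl⟩ := Option.map_eq_some_iff.1 h
    exact ⟨_, _, rfl⟩
  · obtain ⟨q, -, rfl⟩ := List.mem_map.1 h
    exact ⟨_, _, rfl⟩

theorem not_networkSend_mem_deliverLoop {i j k : I} {m : AppMsg I P}
    (e : Finmap (fun _ : ℕ => Rcv P)) (ld : ℕ) (p : SlidingMap (Per I)) :
    Event.networkSend k m ∉ (deliverLoop j e ld p).2.2.2.flatMap (actionEvents i) := by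
  rw [deliverLoop]
  split
  · simp
  · next b hb =>
    have := not_networkSend_mem_deliverLoop (i := i) (j := j) (k := k) (m := m) (e.erase ld) b.mid
      (if b.per then p.add ⟨j, b.mid⟩ else p)
    simpa [actionEvents] using this
termination_by e.keys.card
decreasing_by
  rw [Finmap.keys_erase]
  refine Finset.card_erase_lt_of_mem (Finmap.mem_keys.2 ?_)
  apply Finmap.mem_of_lookup_eq_some
  assumption

theorem core_flatMap_of_sends {i : I} {acts : List (Action I P)}
    (h : ∀ a ∈ acts, ∃ dst w, a = .send dst w) : core (acts.flatMap (actionEvents i)) = [] := by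
  rw [core, List.filter_eq_nil_iff]
  intro e he
  obtain ⟨a, ha, he⟩ := List.mem_flatMap.1 he
  obtain ⟨dst, w, rfl⟩ := h a ha
  cases w <;> simp [actionEvents] at he
  simp [he, Event.isCausal]

theorem core_handle_eq_nil [DecidableEq I] {i : I} {s : State I P} {a : Input I P}
    (ha : ∀ j mid pid per x, a ≠ .receive j (.msg mid pid per x)) :
    core ((handle s a).2.flatMap (actionEvents i)) = [] := by
  match a with
  | .causalSend j x => exact core_flatMap_of_sends fun _ => trySend_sends
  | .receive j (.ack n) => exact core_flatMap_of_sends fun _ => onAck_sends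
  | .receive j (.permit n) => exact core_flatMap_of_sends fun _ => trySend_sends
  | .periodic => exact core_flatMap_of_sends fun _ => onPeriodic_sends
  | .receive j (.msg mid pid per x) => exact absurd rfl (ha j mid pid per x)

/-- A handler that network-sends a message delivers none. -/
theorem core_eq_nil_of_networkSend [DecidableEq I] {i k : I} {s : State I P} {a : Input I P}
    {m : AppMsg I P}
    (h : Event.networkSend k m ∈ (handle s a).2.flatMap (actionEvents i)) :
    core ((handle s a).2.flatMap (actionEvents i)) = [] := by
  by_cases ha : ∃ j mid pid per x, a = .receive j (.msg mid pid per x)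
  · obtain ⟨j, mid, pid, per, x, rfl⟩ := ha
    rw [handle, onMsg] at h
    split_ifs at h
    · simp [actionEvents] at h
    · exact absurd h (not_networkSend_mem_deliverLoop _ _ _)
  · push Not at ha
    exact core_handle_eq_nil ha

theorem Inv.handle [DecidableEq I] {ck : I → ℕ} {st : I → State I P} {N : Set (Packet I P)}
    {t : List (Event I P)} (h : Inv ck st N t) {i : I} {a : Input I P} (ha : Enabled N i a) :
    ∃ ck', Inv ck' (Function.update st i (handle (st i) a).1)
      (N ∪ packetsOf i (CausalDelivery.handle (st i) a).2)
      (t ++ core (inputEvents i (st i) a ++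
        (CausalDelivery.handle (st i) a).2.flatMap (actionEvents i))) := by
  rw [core_append, ← List.append_assoc]
  match a with
  | .causalSend j x =>
    refine ⟨Function.update ck i (ck i + 1), ?_⟩
    rw [core_handle_eq_nil (by simp), List.append_nil]
    exact h.onCausalSend i j x
  | .receive j (.ack n) =>
    refine ⟨ck, ?_⟩
    rw [core_handle_eq_nil (by simp), List.append_nil]
    simpa [inputEvents, core, CausalDelivery.handle] using h.onAck (h.net _ ha)
  | .receive j (.permit n) =>
    refine ⟨ck, ?_⟩
    rw [core_handle_eq_nil (by simp), List.append_nil]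
    simpa [inputEvents, core, CausalDelivery.handle] using h.onPermit (h.net _ ha)
  | .periodic =>
    refine ⟨ck, ?_⟩
    rw [core_handle_eq_nil (by simp), List.append_nil]
    simpa [inputEvents, core, CausalDelivery.handle] using h.onPeriodic i
  | .receive j (.msg mid pid per x) =>
    refine ⟨ck, ?_⟩
    have := h.onMsg (h.net _ ha)
    simpa [inputEvents, core, CausalDelivery.handle, Event.isCausal, List.filter_cons] using this

theorem causalSend_mem_step [DecidableEq I] {i k : I} {s : State I P} {a : Input I P}
    {m : AppMsg I P}
    (h : Event.causalSend k m ∈ inputEvents i s a ++ (handle s a).2.flatMap (actionEvents i)) :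
    m.snd = i ∧ m.mid = s.ck := by
  rcases List.mem_append.1 h with h | h
  · match a with
    | .causalSend j x =>
      simp only [inputEvents, List.mem_singleton, Event.causalSend.injEq] at h
      simp [h.2]
    | .receive j (.msg mid pid per x) => simp [inputEvents] at h
    | .receive j (.ack n) => simp [inputEvents] at h
    | .receive j (.permit n) => simp [inputEvents] at h
    | .periodic => simp [inputEvents] at h
  · obtain ⟨b, -, h⟩ := List.mem_flatMap.1 h
    match b with
    | .deliver j mid x => simp [actionEvents] at h
    | .send j (.msg mid pid per x) => simp [actionEvents] at h
    | .send j (.ack n) => simp [actionEvents] at h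
    | .send j (.permit n) => simp [actionEvents] at h

theorem networkSend_not_mem_inputEvents {i k : I} {s : State I P} {a : Input I P}
    {m : AppMsg I P} : Event.networkSend k m ∉ inputEvents i s a := by
  match a with
  | .causalSend j x => simp [inputEvents]
  | .receive j (.msg mid pid per x) => simp [inputEvents]
  | .receive j (.ack n) => simp [inputEvents]
  | .receive j (.permit n) => simp [inputEvents]
  | .periodic => simp [inputEvents]

theorem deliver_not_mem_inputEvents {i k : I} {s : State I P} {a : Input I P}
    {m : AppMsg I P} : Event.deliver k m ∉ inputEvents i s a := by
  match a with
  | .causalSend j x => simp [inputEvents]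
  | .receive j (.msg mid pid per x) => simp [inputEvents]
  | .receive j (.ack n) => simp [inputEvents]
  | .receive j (.permit n) => simp [inputEvents]
  | .periodic => simp [inputEvents]

theorem networkSend_mem_actionEvents {i k : I} {acts : List (Action I P)} {m : AppMsg I P}
    (h : Event.networkSend k m ∈ acts.flatMap (actionEvents i)) :
    k = i ∧ m.snd = i ∧ ∃ pid per, Action.send m.rcv (.msg m.mid pid per m.pl) ∈ acts := by
  obtain ⟨b, hb, h⟩ := List.mem_flatMap.1 h
  match b with
  | .deliver j mid x => simp [actionEvents] at h
  | .send j (.msg mid pid per x) =>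
    simp only [actionEvents, List.mem_singleton, Event.networkSend.injEq] at h
    obtain ⟨rfl, rfl⟩ := h
    exact ⟨rfl, rfl, pid, per, hb⟩
  | .send j (.ack n) => simp [actionEvents] at h
  | .send j (.permit n) => simp [actionEvents] at h

/-- In every execution the invariant holds, and at each network-send of a message the messages of
other senders in its past have already been delivered. -/
theorem Execution.inv [DecidableEq I] {c : Config I P} {tr : List (Event I P)}
    (h : Execution c tr) :
    (∃ ck, Inv ck c.st c.net (core tr)) ∧
    ∀ i m pre post, tr = pre ++ Event.networkSend i m :: post →
      m.snd = i ∧ Sent (core tr) m ∧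
      ∀ x, HappensBefore (core tr) x m → x.snd ≠ i → Event.deliver x.rcv x ∈ pre := by
  induction h with
  | init => exact ⟨⟨_, inv_init⟩, fun i m pre post h => by simp at h⟩
  | @step c tr i a _ ha ih =>
    obtain ⟨⟨ck, hinv⟩, hsafe⟩ := ih
    obtain ⟨ck', hinv'⟩ := hinv.handle ha
    rw [List.append_assoc, core_append]
    refine ⟨⟨ck', hinv'⟩, fun k m pre post heq => ?_⟩
    have hsplit : (∃ l, pre = tr ++ l ∧ inputEvents i (c.st i) a ++
          (CausalDelivery.handle (c.st i) a).2.flatMap (actionEvents i) =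
            l ++ Event.networkSend k m :: post) ∨
        ∃ l, tr = pre ++ Event.networkSend k m :: l := by
      rcases List.append_eq_append_iff.1 heq with ⟨l, h₁, h₂⟩ | ⟨l, h₁, h₂⟩
      · exact .inl ⟨l, h₁, h₂⟩
      · cases l with
        | nil => exact .inl ⟨[], by simpa using h₁.symm, by simpa using h₂.symm⟩
        | cons e l =>
          rw [List.cons_append, List.cons.injEq] at h₂
          exact .inr ⟨l, by rw [h₁, h₂.1]⟩
    rcases hsplit with ⟨l, rfl, hl⟩ | ⟨l, hl⟩
    · -- The network-send is an event of this step.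
      have hmem : Event.networkSend k m ∈ (CausalDelivery.handle (c.st i) a).2.flatMap
          (actionEvents i) := by
        have : Event.networkSend k m ∈ inputEvents i (c.st i) a ++
            (CausalDelivery.handle (c.st i) a).2.flatMap (actionEvents i) := by
          rw [hl]
          simp
        exact (List.mem_append.1 this).resolve_left networkSend_not_mem_inputEvents
      obtain ⟨rfl, hsnd, pid, per, hact⟩ := networkSend_mem_actionEvents hmem
      subst hsnd
      have hmsg : MsgOK _ m.snd m.rcv m.mid pid per m.pl :=
        hinv'.net ⟨m.snd, m.rcv, .msg m.mid pid per m.pl⟩ (.inr ⟨rfl, hact⟩)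
      refine ⟨rfl, hmsg.sent, fun x hx hne => List.mem_append_left _ ?_⟩
      have hd := hmsg.past x hx hne
      rw [core_append, core_eq_nil_of_networkSend hmem, List.append_nil] at hd
      rcases List.mem_append.1 hd with hd | hd
      · exact (mem_core.1 hd).1
      · exact absurd (mem_core.1 hd).1 deliver_not_mem_inputEvents
    · -- The network-send is an earlier event, and the past of its message has not changed since.
      obtain ⟨hsnd, hs, hx⟩ := hsafe k m pre l hl
      refine ⟨hsnd, List.mem_append_left _ hs, fun x hxm hne => hx x ?_ hne⟩
      refine hxm.of_append hinv.trace (fun k' m' hm' hc => ?_) hs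
      have hnew := causalSend_mem_step (mem_core.1 hc).1
      have := hinv.sent_lt m' hm'
      rw [hnew.1, hnew.2, (hinv.send i).ck_eq] at this
      exact this.false

end Executions

end CausalDelivery

theorem mainTheorem2 {I P : Type*} [DecidableEq I] (c : CausalDelivery.Config I P)
    (tr : List (CausalDelivery.Event I P)) (h : CausalDelivery.Execution c tr) :
    CausalDelivery.EnforcesCSPS tr := by
  intro i m pre post heq k hk _ m' hm' hb
  obtain ⟨⟨ck, hinv⟩, hsafe⟩ := h.inv
  refine (hsafe i m pre post heq).2.2 m' hb.core ?_
  rwa [hinv.trace.snd_eq k m' (CausalDelivery.mem_core.2 ⟨hm', rfl⟩)]
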